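/- Let $\alpha>-1/2$. Put $d\mu_\alpha(x)=(2\pi)^{\alpha+1}x^{2\alpha+1}\,dx$ on $\mathbb R^+$, $L^2_\alpha=L^2(\mathbb R^+,\mu_\alpha)$, and $$j_\alpha(x)=\frac{J_\alpha(x)}{x^\alpha}=\frac1{2^\alpha}\sum_{n\ge0}\frac{(-1)^n}{n!\,\Gamma(n+\alpha+1)}\Big(\frac x2\Big)^{2n}.$$ Let $\mathcal F_\alpha$ be the Fourier--Bessel transform, i.e. the unitary operator of $L^2_\alpha$ that extends $\mathcal F_\alpha f(y)=\int_0^\infty f(x)j_\alpha(2\pi xy)\,d\mu_\alpha(x)$ from $L^1_\alpha\cap L^2_\alpha$. For measurable $A\subset\mathbb R^+$ let $E_A$ and $F_A$ be the orthogonal projections of $L^2_\alpha$ given by $E_Af=\chi_Af$ and $\mathcal F_\alpha(F_Af)=\chi_A\mathcal F_\alpha f$; write $A^c=\mathbb R^+\setminus A$ and $|A|$ for the Lebesgue measure of $A$, and $\|\cdot\|_{HS}$ for the Hilbert--Schmidt norm. There is a constant $\kappa_\alpha$, depending only on $\alpha$, such that $|j_\alpha(t)|\le\kappa_\alpha t^{-\alpha-1/2}$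 for all $t>0$. For every such constant $\kappa_\alpha$ and all measurable $S,\Sigma\subset\mathbb R^+$ of finite Lebesgue measure, $$\|F_\Sigma E_S\|_{HS}\le\kappa_\alpha\sqrt{2\pi|S||\Sigma|}.$$ In particular, if $|S||\Sigma|<\frac1{2\pi}\kappa_\alpha^{-2}$, then for all $f\in L^2_\alpha$, $$\|f\|_{L^2_\alpha}\le\Big(1+\frac1{1-\kappa_\alpha\sqrt{2\pi|S||\Sigma|}}\Big)\Big(\|E_{S^c}f\|_{L^2_\alpha}+\|F_{\Sigma^c}f\|_{L^2_\alpha}\Big).$$ -/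

import Mathlib

open MeasureTheory
open scoped ENNReal

noncomputable section

namespace FourierBessel

/-- The normalized Bessel function `j_α(x) = J_α(x) / x^α`, given by its power series
`2^{-α} ∑ (-1)^n / (n! Γ(n+α+1)) (x/2)^{2n}`. -/
def besselj (α x : ℝ) : ℝ :=
  (1 / (2 : ℝ) ^ α) *
    ∑' n : ℕ, (-1 : ℝ) ^ n / ((n.factorial : ℝ) * Real.Gamma ((n : ℝ) + α + 1)) * (x / 2) ^ (2 * n)

/-- `κ` is an admissible constant in the bound `|j_α(t)| ≤ κ t^{-α-1/2}`, `t > 0`. -/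
def BesselBound (α κ : ℝ) : Prop :=
  ∀ t : ℝ, 0 < t → |besselj α t| ≤ κ * t ^ (-α - 1 / 2)

/-- The measure `dμ_α(x) = (2π)^{α+1} x^{2α+1} dx` on `(0, ∞)`, seen as a measure on `ℝ`
that is concentrated on `(0, ∞)`. -/
def muAlpha (α : ℝ) : Measure ℝ :=
  (volume.restrict (Set.Ioi (0 : ℝ))).withDensity
    (fun x => ENNReal.ofReal ((2 * Real.pi) ^ (α + 1) * x ^ (2 * α + 1)))

/-- The Hilbert space `L²_α(ℝ⁺)` of complex-valued functions. -/
abbrev L2 (α : ℝ) : Type := Lp ℂ 2 (muAlpha α)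

/-- The Fourier-Bessel (Hankel) transform of an integrable function, as an integral. -/
def fourierBesselIntegral (α : ℝ) (f : ℝ → ℂ) (y : ℝ) : ℂ :=
  ∫ x, f x * (besselj α (2 * Real.pi * x * y) : ℂ) ∂(muAlpha α)

/-- `U` is a unitary operator of `L²_α` that is given by the integral on `L¹_α ∩ L²_α`.
Since `L¹_α ∩ L²_α` is dense in `L²_α`, there is at most one such `U`. -/
def IsFourierBessel (α : ℝ) (U : L2 α ≃ₗᵢ[ℂ] L2 α) : Prop :=
  ∀ f : L2 α, Integrable (f : ℝ → ℂ) (muAlpha α) →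
    (U f : ℝ → ℂ) =ᵐ[muAlpha α] fourierBesselIntegral α f

open Classical in
/-- The Fourier-Bessel transform on `L²_α`: the unitary extension of the integral transform from
`L¹_α ∩ L²_α` to `L²_α`. (For `α > -1/2` this extension exists by Plancherel's theorem; the
identity is a default value, used only if there were no such extension.) -/
def fourierBessel (α : ℝ) : L2 α ≃ₗᵢ[ℂ] L2 α :=
  if h : ∃ U : L2 α ≃ₗᵢ[ℂ] L2 α, IsFourierBessel α U then h.choose
  else LinearIsometryEquiv.refl ℂ (L2 α)

/-- The class of `χ_S f` in `L²(μ)`, for `f ∈ L²(μ)`. -/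
def chiMul {μ : Measure ℝ} (S : Set ℝ) (hS : MeasurableSet S) (f : Lp ℂ 2 μ) : Lp ℂ 2 μ :=
  ((Lp.memLp f).indicator hS).toLp (S.indicator f)

theorem coeFn_chiMul {μ : Measure ℝ} (S : Set ℝ) (hS : MeasurableSet S) (f : Lp ℂ 2 μ) :
    (chiMul S hS f : ℝ → ℂ) =ᵐ[μ] S.indicator f :=
  MemLp.coeFn_toLp _

theorem chiMul_add {μ : Measure ℝ} (S : Set ℝ) (hS : MeasurableSet S) (f g : Lp ℂ 2 μ) :
    chiMul S hS (f + g) = chiMul S hS f + chiMul S hS g := by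
  apply Lp.ext
  filter_upwards [coeFn_chiMul S hS (f + g), coeFn_chiMul S hS f, coeFn_chiMul S hS g,
    Lp.coeFn_add f g, Lp.coeFn_add (chiMul S hS f) (chiMul S hS g)] with x h1 h2 h3 h4 h5
  rw [h1, h5, Pi.add_apply, h2, h3]
  by_cases hx : x ∈ S
  · rw [Set.indicator_of_mem hx, Set.indicator_of_mem hx, Set.indicator_of_mem hx, h4,
      Pi.add_apply]
  · rw [Set.indicator_of_notMem hx, Set.indicator_of_notMem hx, Set.indicator_of_notMem hx,
      add_zero]

theorem chiMul_smul {μ : Measure ℝ} (S : Set ℝ) (hS : MeasurableSet S) (c : ℂ) (f : Lp ℂ 2 μ) :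
    chiMul S hS (c • f) = c • chiMul S hS f := by
  apply Lp.ext
  filter_upwards [coeFn_chiMul S hS (c • f), coeFn_chiMul S hS f,
    Lp.coeFn_smul c f, Lp.coeFn_smul c (chiMul S hS f)] with x h1 h2 h3 h4
  rw [h1, h4, Pi.smul_apply, h2]
  by_cases hx : x ∈ S
  · rw [Set.indicator_of_mem hx, Set.indicator_of_mem hx, h3, Pi.smul_apply]
  · rw [Set.indicator_of_notMem hx, Set.indicator_of_notMem hx, smul_zero]

theorem norm_chiMul_le {μ : Measure ℝ} (S : Set ℝ) (hS : MeasurableSet S) (f : Lp ℂ 2 μ) :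
    ‖chiMul S hS f‖ ≤ 1 * ‖f‖ := by
  rw [one_mul]
  apply Lp.norm_le_norm_of_ae_le
  filter_upwards [coeFn_chiMul S hS f] with x h1
  rw [h1]
  exact norm_indicator_le_norm_self _ _

/-- The projection `E_S f = χ_S f` on `L²_α`. -/
def projE (α : ℝ) (S : Set ℝ) (hS : MeasurableSet S) : L2 α →L[ℂ] L2 α :=
  LinearMap.mkContinuous
    { toFun := chiMul S hS
      map_add' := chiMul_add S hS
      map_smul' := chiMul_smul S hS }
    1 (norm_chiMul_le S hS)

/-- The projection `F_Σ` on `L²_α`, determined by `ℱ_α (F_Σ f) = χ_Σ ℱ_α(f)`. -/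
def projF (α : ℝ) (S : Set ℝ) (hS : MeasurableSet S) : L2 α →L[ℂ] L2 α :=
  ((fourierBessel α).symm.toContinuousLinearEquiv : L2 α →L[ℂ] L2 α) ∘L projE α S hS ∘L
    ((fourierBessel α).toContinuousLinearEquiv : L2 α →L[ℂ] L2 α)

theorem fourierBessel_projF (α : ℝ) (S : Set ℝ) (hS : MeasurableSet S) (f : L2 α) :
    fourierBessel α (projF α S hS f) = projE α S hS (fourierBessel α f) := by
  simp [projF]

/-- The Hilbert-Schmidt norm `(∑ ‖T e_i‖²)^{1/2}` of a bounded operator, computed in the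
orthonormal (Hilbert) basis `b = (e_i)`; it is `∞` if `T` is not Hilbert-Schmidt. -/
def hilbertSchmidtNorm {ι H : Type*} [NormedAddCommGroup H] [InnerProductSpace ℂ H]
    (b : HilbertBasis ι ℂ H) (T : H →L[ℂ] H) : ℝ≥0∞ :=
  (∑' i, ‖T (b i)‖ₑ ^ 2) ^ (1 / 2 : ℝ)

end FourierBessel

end

/-!
By Bessel's equation `t^{α+1/2} j_α(t)` solves an `O(t⁻²)` perturbation of `u'' = -u`, and an
energy estimate bounds it at infinity.

Plancherel's theorem is read off the Gaussians `γ_a(x) = √a^{α+1} e^{-πax²}`. Integrating the power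
series of `j_α` term by term shows that the transform maps `γ_a` to `γ_{1/a}`; the inner products
`⟨γ_a, γ_b⟩` do not change under `a, b ↦ 1/a, 1/b`, and the family is total by Weierstrass'
theorem in the variable `e^{-πx²}`. So `γ_a ↦ γ_{1/a}` extends to a unitary operator, which agrees
with the integral on `L¹_α ∩ L²_α` because the integral transform is symmetric.

If `E_S` maps into `L¹_α`, the operator `F_Σ E_S` is, up to `ℱ_α`, an integral operator with kernel
`χ_Σ(y) χ_S(x) j_α(2πxy)`. The densities of the two copies of `μ_α` exactly cancel the decay
`(xy)^{-2α-1}` of `κ² |2πxy|^{-2α-1}`, and Bessel's inequality for each `y` leaves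
`2πκ² |S| |Σ|`. A general `S` is exhausted by sets of finite `μ_α`-measure. Finally the
Hilbert-Schmidt norm dominates the operator norm, and when that is less than `1` the estimate
`‖E f‖ ≤ ‖F E f‖ + ‖(1 - F) E f‖` can be solved for `‖E f‖`.
-/

noncomputable section

namespace FourierBessel

open Filter Topology

theorem hasDerivAt_tsum_mul_pow {a : ℕ → ℝ} (ha : ∀ s, Summable fun n => a n * s ^ n) (s : ℝ) :
    HasDerivAt (fun s => ∑' n, a n * s ^ n) (∑' n : ℕ, (n + 1) * a (n + 1) * s ^ n) s := by
  have hu : Summable fun n : ℕ => ‖a n * (2 * (|s| + 1)) ^ n‖ := (ha _).norm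
  have hbound (n : ℕ) (y : ℝ) (hy : y ∈ Metric.ball 0 (|s| + 1)) :
      ‖a n * (n * y ^ (n - 1))‖ ≤ ‖a n * (2 * (|s| + 1)) ^ n‖ := by
    rw [mem_ball_zero_iff, Real.norm_eq_abs] at hy
    have hR : 1 ≤ |s| + 1 := by linarith [abs_nonneg s]
    rw [norm_mul, norm_mul, norm_mul, mul_pow, norm_mul, norm_pow, norm_pow, norm_pow,
      Real.norm_natCast, Real.norm_ofNat, Real.norm_of_nonneg (by positivity : 0 ≤ |s| + 1)]
    gcongr
    · exact_mod_cast n.lt_two_pow_self.le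
    · calc ‖y‖ ^ (n - 1) ≤ (|s| + 1) ^ (n - 1) := by gcongr; exact hy.le
        _ ≤ (|s| + 1) ^ n := pow_le_pow_right₀ hR n.pred_le
  have hs : s ∈ Metric.ball 0 (|s| + 1) := by simp
  have hderiv := hasDerivAt_tsum_of_isPreconnected hu Metric.isOpen_ball
    (convex_ball (0 : ℝ) (|s| + 1)).isPreconnected
    (fun n y _ => (hasDerivAt_pow n y).const_mul (a n)) hbound hs (ha s) hs
  have hsum : Summable fun n : ℕ => a n * (n * s ^ (n - 1)) :=
    .of_norm_bounded hu fun n => hbound n s hs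
  convert! hderiv using 1
  rw [hsum.tsum_eq_zero_add]
  simp [mul_comm, mul_left_comm]

theorem inv_Gamma_eq_mul_inv_Gamma_add_one (s : ℝ) :
    (Real.Gamma s)⁻¹ = s * (Real.Gamma (s + 1))⁻¹ := by
  rcases eq_or_ne s 0 with rfl | hs
  · simp
  · rw [Real.Gamma_add_one hs, mul_inv, mul_inv_cancel_left₀ hs]

/-- The coefficients of the entire function `besselSeries α`. At a pole of `Γ` the convention
`Γ (-m) = 0 = 0⁻¹` agrees with the value `0` of the entire function `1 / Γ`, so that the
recurrences below hold for every real `α`. -/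
def besselCoeff (α : ℝ) (n : ℕ) : ℝ :=
  (-1 : ℝ) ^ n / ((n.factorial : ℝ) * Real.Gamma ((n : ℝ) + α + 1))

/-- The entire function `s ↦ ∑ (-1)^n / (n! Γ(n+α+1)) s^n`, which is `2^α j_α(x)` at
`s = (x/2)^2`. -/
def besselSeries (α s : ℝ) : ℝ := ∑' n : ℕ, besselCoeff α n * s ^ n

theorem besselCoeff_eq_mul_besselCoeff_add_one (α : ℝ) (n : ℕ) :
    besselCoeff α n = (n + α + 1) * besselCoeff (α + 1) n := by
  have h := inv_Gamma_eq_mul_inv_Gamma_add_one (n + α + 1)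
  rw [besselCoeff, besselCoeff, div_eq_mul_inv, mul_inv, h, div_eq_mul_inv, mul_inv,
    ← add_assoc]
  ring

theorem succ_mul_besselCoeff_succ (α : ℝ) (n : ℕ) :
    ((n : ℝ) + 1) * besselCoeff α (n + 1) = -besselCoeff (α + 1) n := by
  rw [besselCoeff, besselCoeff, Nat.factorial_succ, pow_succ, Nat.cast_mul, Nat.cast_succ,
    add_right_comm (n : ℝ) 1 α, add_assoc (n : ℝ) α 1]
  field_simp

theorem summable_besselCoeff_mul_pow (α s : ℝ) :
    Summable fun n : ℕ => besselCoeff α n * s ^ n := by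
  have hrec (n : ℕ) : ((n : ℝ) + 1) * (n + α + 1) * besselCoeff α (n + 1) = -besselCoeff α n := by
    rw [besselCoeff_eq_mul_besselCoeff_add_one α n, mul_right_comm, succ_mul_besselCoeff_succ]
    ring
  have hlarge : ∀ᶠ n : ℕ in atTop, 2 * |s| ≤ n ∧ -α ≤ (n : ℝ) :=
    (tendsto_natCast_atTop_atTop.eventually_ge_atTop _).and
      (tendsto_natCast_atTop_atTop.eventually_ge_atTop _)
  refine summable_of_ratio_norm_eventually_le (r := 1 / 2) (by norm_num) ?_
  filter_upwards [hlarge] with n ⟨hs, hα⟩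
  have h1 : 1 ≤ (n : ℝ) + α + 1 := by linarith
  have h2 : 0 ≤ ((n : ℝ) + 1) * (n + α + 1) := by positivity
  calc ‖besselCoeff α (n + 1) * s ^ (n + 1)‖
      = |s| * (‖besselCoeff α (n + 1)‖ * ‖s ^ n‖) := by
        rw [pow_succ, norm_mul, norm_mul, Real.norm_eq_abs s]; ring
    _ ≤ 1 / 2 * ((n + 1) * (n + α + 1)) * (‖besselCoeff α (n + 1)‖ * ‖s ^ n‖) := by
        gcongr
        nlinarith
    _ = 1 / 2 * ‖besselCoeff α n * s ^ n‖ := by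
        rw [norm_mul, ← norm_neg (besselCoeff α n), ← hrec, norm_mul _ (besselCoeff α _),
          Real.norm_of_nonneg h2]
        ring

theorem hasDerivAt_besselSeries (α s : ℝ) :
    HasDerivAt (besselSeries α) (-besselSeries (α + 1) s) s := by
  convert! hasDerivAt_tsum_mul_pow (summable_besselCoeff_mul_pow α) s using 1
  simp only [succ_mul_besselCoeff_succ, neg_mul, tsum_neg, besselSeries]

theorem mul_besselSeries_add_two (α s : ℝ) :
    s * besselSeries (α + 2) s = (α + 1) * besselSeries (α + 1) s - besselSeries α s := by
  have hcoeff (n : ℕ) : (α + 1) * besselCoeff (α + 1) n - besselCoeff α n =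
      -(n * besselCoeff (α + 1) n) := by
    rw [besselCoeff_eq_mul_besselCoeff_add_one α n]; ring
  have h0 := summable_besselCoeff_mul_pow α s
  have h1 := (summable_besselCoeff_mul_pow (α + 1) s).mul_left (α + 1)
  have hsum : Summable fun n : ℕ => -(n * besselCoeff (α + 1) n) * s ^ n := by
    refine (h1.sub h0).congr fun n => ?_
    rw [← hcoeff]; ring
  calc s * besselSeries (α + 2) s
      = ∑' n : ℕ, -(((n + 1 : ℕ) : ℝ) * besselCoeff (α + 1) (n + 1)) * s ^ (n + 1) := by
        rw [besselSeries, ← tsum_mul_left]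
        refine tsum_congr fun n => ?_
        rw [Nat.cast_succ, succ_mul_besselCoeff_succ, add_assoc, one_add_one_eq_two]
        ring
    _ = ∑' n : ℕ, -(n * besselCoeff (α + 1) n) * s ^ n := by
        rw [hsum.tsum_eq_zero_add]; simp
    _ = (α + 1) * besselSeries (α + 1) s - besselSeries α s := by
        rw [besselSeries, besselSeries, ← tsum_mul_left, ← h1.tsum_sub h0]
        refine tsum_congr fun n => ?_
        rw [← hcoeff]; ring

theorem besselj_eq (α x : ℝ) :
    besselj α x = 1 / (2 : ℝ) ^ α * besselSeries α ((x / 2) ^ 2) := by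
  simp only [besselj, besselSeries, besselCoeff, pow_mul]

theorem besselj_abs (α x : ℝ) : besselj α |x| = besselj α x := by
  rw [besselj_eq, besselj_eq, div_pow, div_pow, sq_abs]

theorem hasDerivAt_besselj (α x : ℝ) :
    HasDerivAt (besselj α) (-x * besselj (α + 1) x) x := by
  have hsq : HasDerivAt (fun x : ℝ => (x / 2) ^ 2) (x / 2) x := by
    convert! ((hasDerivAt_id x).div_const 2).pow 2 using 1
    simp; ring
  have h := ((hasDerivAt_besselSeries α ((x / 2) ^ 2)).comp x hsq).const_mul (1 / (2 : ℝ) ^ α)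
  rw [show besselj α = _ from funext (besselj_eq α)]
  convert! h using 1
  rw [besselj_eq, Real.rpow_add_one two_ne_zero]
  field_simp

theorem continuous_besselj (α : ℝ) : Continuous (besselj α) :=
  continuous_iff_continuousAt.2 fun x => (hasDerivAt_besselj α x).continuousAt

theorem sq_mul_besselj_add_two (α x : ℝ) :
    x ^ 2 * besselj (α + 2) x = 2 * (α + 1) * besselj (α + 1) x - besselj α x := by
  rw [besselj_eq, besselj_eq, besselj_eq]
  calc _ = 4 * (1 / (2 : ℝ) ^ (α + 2)) * ((x / 2) ^ 2 * besselSeries (α + 2) ((x / 2) ^ 2)) := by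
        ring
    _ = _ := by
        rw [mul_besselSeries_add_two, Real.rpow_add two_pos, Real.rpow_add_one two_ne_zero]
        norm_num
        field_simp

/-- A perturbation `q = O(t⁻²)` of the oscillator `u'' = -u` keeps solutions bounded: the energy
`u² + v²` can only grow by a factor `exp (c / t)`. -/
theorem exists_bound_of_oscillator {u v q : ℝ → ℝ} {c : ℝ}
    (hu : ∀ t, 1 ≤ t → HasDerivAt u (-v t) t)
    (hv : ∀ t, 1 ≤ t → HasDerivAt v ((1 + q t) * u t) t)
    (hq : ∀ t, 1 ≤ t → |q t| ≤ c / t ^ 2) : ∃ C, ∀ t, 1 ≤ t → |u t| ≤ C := by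
  let W : ℝ → ℝ := fun t => (u t ^ 2 + v t ^ 2) * Real.exp (c / t)
  have hW (t : ℝ) (ht : 1 ≤ t) : HasDerivAt W
      ((2 * q t * u t * v t - c / t ^ 2 * (u t ^ 2 + v t ^ 2)) * Real.exp (c / t)) t := by
    have ht0 : t ≠ 0 := by positivity
    convert! (((hu t ht).pow 2).add ((hv t ht).pow 2)).mul
      ((hasDerivAt_inv ht0).const_mul c).exp using 1
    simp only [Pi.add_apply, Pi.pow_apply, ← div_eq_mul_inv]
    ring
  have hW_nonpos (t : ℝ) (ht : 1 ≤ t) :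
      (2 * q t * u t * v t - c / t ^ 2 * (u t ^ 2 + v t ^ 2)) * Real.exp (c / t) ≤ 0 := by
    refine mul_nonpos_of_nonpos_of_nonneg ?_ (Real.exp_pos _).le
    have h1 : 2 * (u t * v t) ≤ u t ^ 2 + v t ^ 2 := by linarith [two_mul_le_add_sq (u t) (v t)]
    have h2 : -(u t ^ 2 + v t ^ 2) ≤ 2 * (u t * v t) := by nlinarith [sq_nonneg (u t + v t)]
    nlinarith [abs_le.1 (hq t ht)]
  have hanti : AntitoneOn W (Set.Ici 1) := by
    refine antitoneOn_of_hasDerivWithinAt_nonpos (convex_Ici 1)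
      (fun t ht => (hW t ht).continuousAt.continuousWithinAt)
      (fun t ht => (hW t (interior_subset ht)).hasDerivWithinAt)
      fun t ht => hW_nonpos t (interior_subset ht)
  have hc : 0 ≤ c := by simpa using (abs_nonneg _).trans (hq 1 le_rfl)
  refine ⟨√(W 1), fun t ht => Real.abs_le_sqrt ?_⟩
  calc u t ^ 2 ≤ u t ^ 2 + v t ^ 2 := le_add_of_nonneg_right (sq_nonneg _)
    _ ≤ W t := le_mul_of_one_le_right (by positivity) (Real.one_le_exp (by positivity))
    _ ≤ W 1 := hanti Set.self_mem_Ici ht ht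

/-- By Bessel's equation, `u = t^{α+1/2} j_α` satisfies `u'' = -(1 + (1/4 - α²) / t²) u`. -/
theorem exists_bound_rpow_mul_besselj (α : ℝ) :
    ∃ C : ℝ, ∀ t : ℝ, 1 ≤ t → |t ^ (α + 1 / 2) * besselj α t| ≤ C := by
  set b : ℝ := α + 1 / 2 with hb
  have hpow {t : ℝ} (ht : 1 ≤ t) : HasDerivAt (fun t : ℝ => t ^ b) (b / t * t ^ b) t := by
    have ht0 : t ≠ 0 := by positivity
    convert! Real.hasDerivAt_rpow_const (p := b) (Or.inl ht0) using 1
    rw [Real.rpow_sub_one ht0]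
    field_simp
  refine exists_bound_of_oscillator (q := fun t => (1 / 4 - α ^ 2) / t ^ 2)
    (v := fun t => t ^ b * (t * besselj (α + 1) t - b / t * besselj α t))
    (c := |1 / 4 - α ^ 2|) (fun t ht => ?_) (fun t ht => ?_) fun t _ => ?_
  · convert! (hpow ht).mul (hasDerivAt_besselj α t) using 1
    ring
  · have ht0 : t ≠ 0 := by positivity
    have h1 := (hasDerivAt_id t).mul (hasDerivAt_besselj (α + 1) t)
    have h2 := ((hasDerivAt_inv ht0).const_mul b).mul (hasDerivAt_besselj α t)
    convert! (hpow ht).mul (h1.sub h2) using 1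
    have hrec : besselj α t = 2 * (α + 1) * besselj (α + 1) t - t ^ 2 * besselj (α + 2) t := by
      linarith [sq_mul_besselj_add_two α t]
    rw [add_assoc, one_add_one_eq_two]
    simp only [id, Pi.sub_apply, Pi.mul_apply, hrec, hb]
    field_simp
    ring
  · rw [abs_div, abs_of_nonneg (sq_nonneg t)]

section Bound

variable {α : ℝ}

theorem exists_bound_besselj_Icc (α : ℝ) : ∃ D, ∀ t ∈ Set.Icc (0 : ℝ) 1, |besselj α t| ≤ D :=
  isCompact_Icc.exists_bound_of_continuousOn (continuous_besselj α).continuousOn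

theorem BesselBound.nonneg {κ : ℝ} (h : BesselBound α κ) : 0 ≤ κ := by
  simpa using (abs_nonneg _).trans (h 1 one_pos)

theorem exists_besselBound (hα : -1 / 2 ≤ α) : ∃ κ : ℝ, BesselBound α κ := by
  obtain ⟨C, hC⟩ := exists_bound_rpow_mul_besselj α
  obtain ⟨D, hD⟩ := exists_bound_besselj_Icc α
  have hD0 : 0 ≤ D := (abs_nonneg _).trans (hD 0 (by simp))
  refine ⟨max C D, fun t ht => ?_⟩
  rcases le_total t 1 with h | h
  · calc |besselj α t| ≤ D := hD t ⟨ht.le, h⟩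
      _ ≤ D * t ^ (-α - 1 / 2) := le_mul_of_one_le_right hD0 <|
          Real.one_le_rpow_of_pos_of_le_one_of_nonpos ht h (by linarith)
      _ ≤ max C D * t ^ (-α - 1 / 2) := by gcongr; exact le_max_right _ _
  · have hp : 0 < t ^ (α + 1 / 2) := Real.rpow_pos_of_pos ht _
    rw [show -α - 1 / 2 = -(α + 1 / 2) by ring, Real.rpow_neg ht.le, ← div_eq_mul_inv,
      le_div_iff₀' hp]
    calc t ^ (α + 1 / 2) * |besselj α t| = |t ^ (α + 1 / 2) * besselj α t| := by
          rw [abs_mul, abs_of_pos hp]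
      _ ≤ max C D := (hC t h).trans (le_max_left _ _)

theorem exists_bound_besselj (hα : -1 / 2 ≤ α) : ∃ C : ℝ, ∀ t : ℝ, |besselj α t| ≤ C := by
  obtain ⟨κ, hκ⟩ := exists_besselBound hα
  obtain ⟨D, hD⟩ := exists_bound_besselj_Icc α
  refine ⟨max κ D, fun t => ?_⟩
  rw [← besselj_abs]
  rcases le_total |t| 1 with h | h
  · exact (hD |t| ⟨abs_nonneg t, h⟩).trans (le_max_right _ _)
  · calc |besselj α (|t|)| ≤ κ * |t| ^ (-α - 1 / 2) := hκ |t| (one_pos.trans_le h)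
      _ ≤ κ := mul_le_of_le_one_right hκ.nonneg <|
          (Real.rpow_le_one_of_one_le_of_nonpos h (by linarith))
      _ ≤ max κ D := le_max_left _ _

end Bound

section Moments

variable {X E : Type*} [MeasurableSpace X] {μ : Measure X} [NormedAddCommGroup E]
  [NormedSpace ℝ E] {T : X → ℝ} {h : X → E} {a b : ℝ}

theorem integrable_comp_smul (hT : AEStronglyMeasurable T μ) (hTab : ∀ x, T x ∈ Set.Icc a b)
    (hh : Integrable h μ) {G : ℝ → ℝ} (hG : Continuous G) :
    Integrable (fun x => G (T x) • h x) μ := by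
  obtain ⟨C, hC⟩ := isCompact_Icc.exists_bound_of_continuousOn hG.continuousOn (s := Set.Icc a b)
  exact hh.bdd_smul C (hG.comp_aestronglyMeasurable hT) (.of_forall fun x => hC _ (hTab x))

theorem integral_comp_smul_eq_zero (hT : AEStronglyMeasurable T μ)
    (hTab : ∀ x, T x ∈ Set.Icc a b) (hh : Integrable h μ)
    (hmoments : ∀ n : ℕ, ∫ x, T x ^ n • h x ∂μ = 0) {G : ℝ → ℝ} (hG : Continuous G) :
    ∫ x, G (T x) • h x ∂μ = 0 := by
  have hpoly (p : Polynomial ℝ) : ∫ x, p.eval (T x) • h x ∂μ = 0 := by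
    have hint (n : ℕ) : Integrable (fun x => p.coeff n • T x ^ n • h x) μ :=
      (integrable_comp_smul hT hTab hh (continuous_pow n)).smul _
    simp only [Polynomial.eval_eq_sum_range, Finset.sum_smul, mul_smul]
    simp only [integral_finsetSum _ fun n _ => hint n, integral_smul, hmoments, smul_zero,
      Finset.sum_const_zero]
  have hsmall (ε : ℝ) (hε : 0 < ε) :
      ‖∫ x, G (T x) • h x ∂μ‖ ≤ ε * ∫ x, ‖h x‖ ∂μ := by
    obtain ⟨p, hp⟩ := exists_polynomial_near_of_continuousOn a b G hG.continuousOn ε hε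
    rw [← sub_zero (∫ x, _ ∂μ), ← hpoly p, ← integral_sub (integrable_comp_smul hT hTab hh hG)
      (integrable_comp_smul hT hTab hh p.continuous), ← integral_const_mul]
    refine norm_integral_le_of_norm_le (hh.norm.const_mul ε) (.of_forall fun x => ?_)
    rw [← sub_smul, norm_smul, norm_sub_rev]
    gcongr
    exact (hp _ (hTab x)).le
  have hlim : Tendsto (fun ε : ℝ => ε * ∫ x, ‖h x‖ ∂μ) (𝓝[>] 0) (𝓝 0) :=
    ((continuous_mul_const _).tendsto' 0 0 (zero_mul _)).mono_left nhdsWithin_le_nhds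
  exact norm_le_zero_iff.1 (ge_of_tendsto hlim (eventually_mem_nhdsWithin.mono hsmall))

theorem setIntegral_preimage_eq_zero (hT : Measurable T) (hTab : ∀ x, T x ∈ Set.Icc a b)
    (hh : Integrable h μ) (hmoments : ∀ n : ℕ, ∫ x, T x ^ n • h x ∂μ = 0) {F : Set ℝ}
    (hF : IsClosed F) : ∫ x in T ⁻¹' F, h x ∂μ = 0 := by
  obtain ⟨δ, -, hδ_pos, hδ⟩ := exists_seq_strictAnti_tendsto (0 : ℝ)
  let G (n : ℕ) (y : ℝ) : ℝ := thickenedIndicator (hδ_pos n) F y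
  have hG (n : ℕ) : Continuous (G n) :=
    NNReal.continuous_coe.comp (thickenedIndicator (hδ_pos n) F).continuous
  have hlim (x : X) : Tendsto (fun n => G n (T x) • h x) atTop
      (𝓝 ((T ⁻¹' F).indicator h x)) := by
    have hind := tendsto_pi_nhds.1 (thickenedIndicator_tendsto_indicator_closure hδ_pos hδ F) (T x)
    rw [hF.closure_eq] at hind
    convert! ((NNReal.tendsto_coe.2 hind).smul_const (h x)) using 2
    by_cases hx : T x ∈ F <;> simp [hx]
  rw [← integral_indicator (hT hF.measurableSet)]
  refine tendsto_nhds_unique (tendsto_integral_of_dominated_convergence (fun x => ‖h x‖)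
    (fun n => (integrable_comp_smul hT.aestronglyMeasurable hTab hh (hG n)).1) hh.norm
    (fun n => .of_forall fun x => ?_) (.of_forall hlim)) ?_
  · rw [norm_smul, NNReal.norm_eq]
    exact mul_le_of_le_one_left (norm_nonneg _) (thickenedIndicator_le_one (hδ_pos n) F (T x))
  · simp only [integral_comp_smul_eq_zero hT.aestronglyMeasurable hTab hh hmoments (hG _),
      tendsto_const_nhds]

theorem ae_eq_zero_of_integral_pow_smul_eq_zero [TopologicalSpace X] [T2Space X]
    [SigmaCompactSpace X] [BorelSpace X] [CompleteSpace E] (hT : Continuous T)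
    (hTab : ∀ x, T x ∈ Set.Icc a b) {s : Set X} (hs : IsClosed s) (hTs : Set.InjOn T s)
    (hμ : ∀ᵐ x ∂μ, x ∈ s) (hh : Integrable h μ)
    (hmoments : ∀ n : ℕ, ∫ x, T x ^ n • h x ∂μ = 0) : h =ᵐ[μ] 0 := by
  refine ae_eq_zero_of_forall_setIntegral_isCompact_eq_zero' hh.locallyIntegrable fun K hK => ?_
  have hclosed : IsClosed (T '' (K ∩ s)) := ((hK.inter_right hs).image hT).isClosed
  rw [← setIntegral_preimage_eq_zero hT.measurable hTab hh hmoments hclosed]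
  refine setIntegral_congr_set ?_
  filter_upwards [hμ] with x hx
  refine propext ⟨fun hxK => ⟨x, ⟨hxK, hx⟩, rfl⟩, ?_⟩
  rintro ⟨y, ⟨hyK, hys⟩, hy⟩
  rwa [← hTs hys hx hy]

end Moments

/-- The Gaussian `x ↦ exp (-π a x²)`. -/
def gauss (a x : ℝ) : ℝ := Real.exp (-(Real.pi * a) * x ^ 2)

theorem continuous_gauss (a : ℝ) : Continuous (gauss a) := by
  unfold gauss
  fun_prop

theorem gauss_pos (a x : ℝ) : 0 < gauss a x := Real.exp_pos _

theorem gauss_le_one {a : ℝ} (ha : 0 ≤ a) (x : ℝ) : gauss a x ≤ 1 := by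
  rw [gauss, Real.exp_le_one_iff, neg_mul, neg_nonpos]
  positivity

theorem gauss_mul_gauss (a b x : ℝ) : gauss a x * gauss b x = gauss (a + b) x := by
  rw [gauss, gauss, gauss, ← Real.exp_add]
  ring_nf

theorem gauss_one_pow (n : ℕ) (x : ℝ) : gauss 1 x ^ n = gauss n x := by
  rw [gauss, gauss, ← Real.exp_nat_mul]
  ring_nf

theorem injOn_gauss_one : Set.InjOn (gauss 1) (Set.Ici 0) := fun x hx y hy hxy => by
  have hsq : x ^ 2 = y ^ 2 := mul_left_cancel₀
    (by simp [Real.pi_ne_zero]) (Real.exp_injective hxy)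
  exact (sq_eq_sq₀ hx hy).1 hsq

theorem ae_eq_zero_of_integral_gauss_smul_eq_zero {E : Type*} [NormedAddCommGroup E]
    [NormedSpace ℝ E] [CompleteSpace E] {μ : Measure ℝ} (hμ : ∀ᵐ x ∂μ, x ∈ Set.Ici 0)
    {h : ℝ → E} (hh : Integrable (fun x => gauss 1 x • h x) μ)
    (h0 : ∀ n : ℕ, ∫ x, gauss (n + 1) x • h x ∂μ = 0) : h =ᵐ[μ] 0 := by
  have hzero : (fun x => gauss 1 x • h x) =ᵐ[μ] 0 := by
    refine ae_eq_zero_of_integral_pow_smul_eq_zero (continuous_gauss 1)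
      (fun x => ⟨(gauss_pos 1 x).le, gauss_le_one zero_le_one x⟩) isClosed_Ici injOn_gauss_one
      hμ hh fun n => ?_
    simp only [smul_smul, gauss_one_pow, gauss_mul_gauss, h0]
  filter_upwards [hzero] with x hx
  exact (smul_eq_zero.1 hx).resolve_left (gauss_pos 1 x).ne'

/-- The density of `μ_α` on `(0, ∞)`. -/
def muAlphaDensity (α x : ℝ) : ℝ := (2 * Real.pi) ^ (α + 1) * x ^ (2 * α + 1)

theorem muAlpha_eq (α : ℝ) : muAlpha α = (volume.restrict (Set.Ioi 0)).withDensity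
    fun x => ENNReal.ofReal (muAlphaDensity α x) :=
  rfl

theorem measurable_muAlphaDensity (α : ℝ) : Measurable (muAlphaDensity α) := by
  unfold muAlphaDensity
  fun_prop

theorem muAlphaDensity_pos (α : ℝ) {x : ℝ} (hx : 0 < x) : 0 < muAlphaDensity α x := by
  unfold muAlphaDensity
  positivity

theorem ae_muAlpha_pos (α : ℝ) : ∀ᵐ x ∂(muAlpha α), 0 < x :=
  (withDensity_absolutelyContinuous _ _).ae_le (ae_restrict_mem measurableSet_Ioi)

instance sigmaFinite_muAlpha (α : ℝ) : SigmaFinite (muAlpha α) :=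
  SigmaFinite.withDensity_ofReal _

section Density

variable {E : Type*} [NormedAddCommGroup E] [NormedSpace ℝ E]

theorem integral_muAlpha (α : ℝ) (f : ℝ → E) :
    ∫ x, f x ∂(muAlpha α) = ∫ x in Set.Ioi 0, muAlphaDensity α x • f x := by
  rw [muAlpha_eq, integral_withDensity_eq_integral_toReal_smul
    (measurable_muAlphaDensity α).ennreal_ofReal (by simp)]
  exact setIntegral_congr_fun measurableSet_Ioi fun x hx => by
    rw [ENNReal.toReal_ofReal (muAlphaDensity_pos α hx).le]

theorem integrable_muAlpha_iff (α : ℝ) (f : ℝ → E) : Integrable f (muAlpha α) ↔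
    IntegrableOn (fun x => muAlphaDensity α x • f x) (Set.Ioi 0) := by
  rw [muAlpha_eq, integrable_withDensity_iff_integrable_smul'
    (measurable_muAlphaDensity α).ennreal_ofReal (by simp)]
  exact integrableOn_congr_fun (fun x hx => by
    rw [ENNReal.toReal_ofReal (muAlphaDensity_pos α hx).le]) measurableSet_Ioi

end Density

section GaussianMoments

variable {α a : ℝ}

theorem muAlphaDensity_smul_pow_mul_gauss (α a : ℝ) (n : ℕ) {x : ℝ} (hx : x ∈ Set.Ioi 0) :
    muAlphaDensity α x • (x ^ (2 * n) * gauss a x) =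
      (2 * Real.pi) ^ (α + 1) *
        (x ^ (2 * (n + α + 1) - 1) * Real.exp (-(Real.pi * a) * x ^ 2)) := by
  rw [show 2 * ((n : ℝ) + α + 1) - 1 = 2 * α + 1 + (2 * n : ℕ) by push_cast; ring,
    Real.rpow_add (Set.mem_Ioi.1 hx) (2 * α + 1), Real.rpow_natCast, gauss, smul_eq_mul,
    muAlphaDensity]
  ring

theorem integrable_pow_mul_gauss (hα : -1 < α) (ha : 0 < a) (n : ℕ) :
    Integrable (fun x => x ^ (2 * n) * gauss a x) (muAlpha α) := by
  have : (0 : ℝ) ≤ n := n.cast_nonneg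
  rw [integrable_muAlpha_iff, integrableOn_congr_fun
    (fun x hx => muAlphaDensity_smul_pow_mul_gauss α a n hx) measurableSet_Ioi]
  exact (integrableOn_rpow_mul_exp_neg_mul_sq (mul_pos Real.pi_pos ha) (by linarith)).const_mul _

theorem integral_pow_mul_gauss (hα : -1 < α) (ha : 0 < a) (n : ℕ) :
    ∫ x, x ^ (2 * n) * gauss a x ∂(muAlpha α) =
      2 ^ α * Real.Gamma (n + α + 1) * a ^ (-(α + 1)) / (Real.pi * a) ^ n := by
  have : (0 : ℝ) ≤ n := n.cast_nonneg
  have hπ := Real.pi_pos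
  have h := integral_rpow_mul_exp_neg_mul_rpow (p := 2) (q := 2 * (n + α + 1) - 1) two_pos
    (by linarith) (mul_pos hπ ha)
  simp only [Real.rpow_two] at h
  rw [integral_muAlpha, setIntegral_congr_fun measurableSet_Ioi
    (fun x hx => muAlphaDensity_smul_pow_mul_gauss α a n hx), integral_const_mul, h,
    show -(2 * ((n : ℝ) + α + 1) - 1 + 1) / 2 = -(α + 1) - n by ring,
    show (2 * ((n : ℝ) + α + 1) - 1 + 1) / 2 = n + α + 1 by ring,
    Real.rpow_sub (by positivity), Real.rpow_natCast, Real.mul_rpow two_pos.le hπ.le,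
    Real.mul_rpow hπ.le ha.le, Real.rpow_neg hπ.le, Real.rpow_add_one two_ne_zero]
  field_simp

theorem integrable_gauss (hα : -1 < α) (ha : 0 < a) : Integrable (gauss a) (muAlpha α) := by
  simpa using integrable_pow_mul_gauss hα ha 0

theorem integral_gauss (hα : -1 < α) (ha : 0 < a) :
    ∫ x, gauss a x ∂(muAlpha α) = 2 ^ α * Real.Gamma (α + 1) * a ^ (-(α + 1)) := by
  simpa using integral_pow_mul_gauss hα ha 0

theorem integral_gauss_mul_besselj (hα : -1 < α) (ha : 0 < a) (y : ℝ) :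
    ∫ x, gauss a x * besselj α (2 * Real.pi * x * y) ∂(muAlpha α) =
      a ^ (-(α + 1)) * gauss a⁻¹ y := by
  let c (n : ℕ) : ℝ := 1 / (2 : ℝ) ^ α * besselCoeff α n * (Real.pi * y) ^ (2 * n)
  let m (n : ℕ) (x : ℝ) : ℝ := x ^ (2 * n) * gauss a x
  let e (n : ℕ) : ℝ := a ^ (-(α + 1)) * ((-(Real.pi * a⁻¹) * y ^ 2) ^ n / n.factorial)
  have hseries (x : ℝ) : gauss a x * besselj α (2 * Real.pi * x * y) = ∑' n, c n * m n x := by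
    rw [besselj_eq, besselSeries, ← tsum_mul_left, ← tsum_mul_left]
    refine tsum_congr fun n => ?_
    rw [show 2 * Real.pi * x * y / 2 = Real.pi * y * x by ring, ← pow_mul, mul_pow _ x]
    ring
  have hterm (n : ℕ) : c n * ∫ x, m n x ∂(muAlpha α) = e n := by
    have hΓ : Real.Gamma (n + α + 1) ≠ 0 :=
      (Real.Gamma_pos_of_pos (by linarith [n.cast_nonneg (α := ℝ)])).ne'
    have := Real.pi_pos
    rw [show ∫ x, m n x ∂(muAlpha α) = _ from integral_pow_mul_gauss hα ha n]
    simp only [c, e, besselCoeff, pow_mul, mul_pow, neg_mul,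
      neg_pow (Real.pi * a⁻¹ * y ^ 2), inv_pow]
    field_simp
    ring
  have hnorm (n : ℕ) : ∫ x, ‖c n * m n x‖ ∂(muAlpha α) = |e n| := by
    have hpos (x : ℝ) : 0 ≤ m n x := mul_nonneg ((even_two_mul n).pow_nonneg x) (gauss_pos a x).le
    rw [← hterm, abs_mul, abs_of_nonneg (integral_nonneg hpos), ← integral_const_mul]
    congr 1 with x
    rw [norm_mul, Real.norm_eq_abs, Real.norm_of_nonneg (hpos x)]
  have hsum : Summable e := (Real.summable_pow_div_factorial _).mul_left _
  have hswap := hasSum_integral_of_summable_integral_norm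
    (fun n => (integrable_pow_mul_gauss hα ha n).const_mul (c n))
    (hsum.abs.congr fun n => (hnorm n).symm)
  calc _ = ∑' n, ∫ x, c n * m n x ∂(muAlpha α) := by simp only [hseries, hswap.tsum_eq, m]
    _ = ∑' n, e n := by simp only [integral_const_mul, hterm]
    _ = a ^ (-(α + 1)) * gauss a⁻¹ y := by
      rw [tsum_mul_left, gauss, Real.exp_eq_exp_ℝ, NormedSpace.exp_eq_tsum_div]

end GaussianMoments

/-- The dilation `√a^{α+1} e^{-πax²}` of the Gaussian `e^{-πx²}`, normalised so that its norm in
`L²_α` does not depend on `a`. -/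
def dilatedGauss (α a x : ℝ) : ℂ := (√a ^ (α + 1) * gauss a x : ℝ)

section DilatedGauss

variable {α a b : ℝ}

theorem continuous_dilatedGauss (α a : ℝ) : Continuous (dilatedGauss α a) :=
  Complex.continuous_ofReal.comp (continuous_const.mul (continuous_gauss a))

theorem integrable_dilatedGauss (hα : -1 < α) (ha : 0 < a) :
    Integrable (dilatedGauss α a) (muAlpha α) :=
  ((integrable_gauss hα ha).const_mul _).ofReal

theorem dilatedGauss_mul (α a b x : ℝ) : dilatedGauss α a x * dilatedGauss α b x =
    (√a ^ (α + 1) * √b ^ (α + 1) * gauss (a + b) x : ℝ) := by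
  rw [dilatedGauss, dilatedGauss, ← gauss_mul_gauss]
  push_cast
  ring

theorem integral_dilatedGauss_mul_dilatedGauss (hα : -1 < α) (ha : 0 < a) (hb : 0 < b) :
    ∫ x, dilatedGauss α a x * dilatedGauss α b x ∂(muAlpha α) =
      (2 ^ α * Real.Gamma (α + 1) * (√a * √b / (a + b)) ^ (α + 1) : ℝ) := by
  simp only [dilatedGauss_mul]
  rw [integral_complex_ofReal, integral_const_mul, integral_gauss hα (add_pos ha hb),
    Real.div_rpow (by positivity) (by positivity), Real.mul_rpow (by positivity) (by positivity),
    Real.rpow_neg (by positivity)]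
  congr 1
  ring

theorem memLp_dilatedGauss (hα : -1 < α) (ha : 0 < a) :
    MemLp (dilatedGauss α a) 2 (muAlpha α) := by
  refine (memLp_two_iff_integrable_sq_norm
    (continuous_dilatedGauss α a).aestronglyMeasurable).2 ?_
  refine ((integrable_gauss hα (add_pos ha ha)).const_mul
    (√a ^ (α + 1) * √a ^ (α + 1))).congr (.of_forall fun x => ?_)
  change _ = ‖dilatedGauss α a x‖ ^ 2
  rw [← norm_pow, sq, dilatedGauss_mul, Complex.norm_of_nonneg]
  exact mul_nonneg (by positivity) (gauss_pos _ x).le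

theorem fourierBesselIntegral_dilatedGauss (hα : -1 < α) (ha : 0 < a) :
    fourierBesselIntegral α (dilatedGauss α a) = dilatedGauss α a⁻¹ := by
  ext y
  have hcoeff : √a ^ (α + 1) * a ^ (-(α + 1)) = √a⁻¹ ^ (α + 1) := by
    nth_rw 2 [← Real.mul_self_sqrt ha.le]
    rw [Real.mul_rpow (by positivity) (by positivity), Real.sqrt_inv,
      Real.inv_rpow (by positivity), Real.rpow_neg (by positivity)]
    field_simp
  simp only [fourierBesselIntegral, dilatedGauss, ← Complex.ofReal_mul, mul_assoc (√a ^ (α + 1))]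
  rw [integral_complex_ofReal, integral_const_mul, integral_gauss_mul_besselj hα ha, ← mul_assoc,
    hcoeff]

theorem ae_eq_zero_of_integral_mul_dilatedGauss_eq_zero {h : ℝ → ℂ}
    (hh : Integrable (fun x => h x * dilatedGauss α 1 x) (muAlpha α))
    (h0 : ∀ a, 0 < a → ∫ x, h x * dilatedGauss α a x ∂(muAlpha α) = 0) :
    h =ᵐ[muAlpha α] 0 := by
  have hsmul (a x : ℝ) :
      h x * dilatedGauss α a x = ((√a ^ (α + 1) : ℝ) : ℂ) * gauss a x • h x := by
    rw [dilatedGauss, Complex.real_smul]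
    push_cast
    ring
  refine ae_eq_zero_of_integral_gauss_smul_eq_zero ((ae_muAlpha_pos α).mono fun x => le_of_lt)
    ?_ fun n => ?_
  · simpa [hsmul] using hh
  · have hn := h0 (n + 1) (by positivity)
    simp only [hsmul, integral_const_mul] at hn
    refine (mul_eq_zero.1 hn).resolve_left ?_
    exact_mod_cast (show √((n : ℝ) + 1) ^ (α + 1) ≠ 0 by positivity)

end DilatedGauss

section TotalFamilies

variable {𝕜 ι E F : Type*} [RCLike 𝕜] [NormedAddCommGroup E] [InnerProductSpace 𝕜 E]
  [NormedAddCommGroup F] [InnerProductSpace 𝕜 F]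

theorem norm_linearCombination_eq_of_inner_eq {v : ι → E} {w : ι → F}
    (h : ∀ i j, inner 𝕜 (v i) (v j) = inner 𝕜 (w i) (w j)) (x : ι →₀ 𝕜) :
    ‖Finsupp.linearCombination 𝕜 v x‖ = ‖Finsupp.linearCombination 𝕜 w x‖ := by
  rw [@norm_eq_sqrt_re_inner 𝕜, @norm_eq_sqrt_re_inner 𝕜 F]
  simp only [Finsupp.linearCombination_apply, Finsupp.sum_inner, Finsupp.inner_sum, h,
    inner_smul_left, inner_smul_right]

theorem denseRange_linearCombination {v : ι → E}
    (hv : (Submodule.span 𝕜 (Set.range v)).topologicalClosure = ⊤) :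
    DenseRange (Finsupp.linearCombination 𝕜 v) := by
  rw [← Finsupp.range_linearCombination,
    ← Submodule.dense_iff_topologicalClosure_eq_top] at hv
  exact hv

theorem exists_linearIsometryEquiv_of_inner_eq [CompleteSpace E] [CompleteSpace F] {v : ι → E}
    {w : ι → F} (hv : (Submodule.span 𝕜 (Set.range v)).topologicalClosure = ⊤)
    (hw : (Submodule.span 𝕜 (Set.range w)).topologicalClosure = ⊤)
    (h : ∀ i j, inner 𝕜 (v i) (v j) = inner 𝕜 (w i) (w j)) :
    ∃ U : E ≃ₗᵢ[𝕜] F, ∀ i, U (v i) = w i := by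
  let U := (LinearEquiv.refl 𝕜 (ι →₀ 𝕜)).extendOfIsometry (Finsupp.linearCombination 𝕜 v)
    (Finsupp.linearCombination 𝕜 w) (denseRange_linearCombination hv)
    (denseRange_linearCombination hw) fun x => (norm_linearCombination_eq_of_inner_eq h x).symm
  refine ⟨U, fun i => ?_⟩
  have hi : U (Finsupp.linearCombination 𝕜 v (Finsupp.single i 1)) =
      Finsupp.linearCombination 𝕜 w (Finsupp.single i 1) :=
    LinearEquiv.extendOfIsometry_eq ..
  simpa using hi

end TotalFamilies

section Unitary

variable {α : ℝ}

/-- The dilated Gaussian as an element of `L²_α`. -/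
def dilatedGaussLp (hα : -1 < α) (a : {a : ℝ // 0 < a}) : L2 α :=
  (memLp_dilatedGauss hα a.2).toLp _

theorem coeFn_dilatedGaussLp (hα : -1 < α) (a : {a : ℝ // 0 < a}) :
    dilatedGaussLp hα a =ᵐ[muAlpha α] dilatedGauss α a :=
  MemLp.coeFn_toLp _

theorem inner_dilatedGaussLp (hα : -1 < α) (a : {a : ℝ // 0 < a}) (f : L2 α) :
    inner ℂ (dilatedGaussLp hα a) f = ∫ x, f x * dilatedGauss α a x ∂(muAlpha α) := by
  rw [L2.inner_def]
  refine integral_congr_ae ?_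
  filter_upwards [coeFn_dilatedGaussLp hα a] with x hx
  rw [hx, RCLike.inner_apply, dilatedGauss, Complex.conj_ofReal]

theorem inner_dilatedGaussLp_dilatedGaussLp (hα : -1 < α) (a b : {a : ℝ // 0 < a}) :
    inner ℂ (dilatedGaussLp hα a) (dilatedGaussLp hα b) =
      (2 ^ α * Real.Gamma (α + 1) * (√(a : ℝ) * √(b : ℝ) / (a + b)) ^ (α + 1) : ℝ) := by
  rw [inner_dilatedGaussLp, add_comm (a : ℝ), mul_comm √(a : ℝ),
    ← integral_dilatedGauss_mul_dilatedGauss hα b.2 a.2]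
  refine integral_congr_ae ?_
  filter_upwards [coeFn_dilatedGaussLp hα b] with x hx
  rw [hx]

theorem inner_dilatedGaussLp_inv (hα : -1 < α) (a b : {a : ℝ // 0 < a}) :
    inner ℂ (dilatedGaussLp hα a⁻¹) (dilatedGaussLp hα b⁻¹) =
      inner ℂ (dilatedGaussLp hα a) (dilatedGaussLp hα b) := by
  obtain ⟨a, ha⟩ := a
  obtain ⟨b, hb⟩ := b
  have hinv : √a⁻¹ * √b⁻¹ / (a⁻¹ + b⁻¹) = √a * √b / (a + b) := by
    have hsqa := Real.sq_sqrt ha.le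
    have hsqb := Real.sq_sqrt hb.le
    rw [Real.sqrt_inv, Real.sqrt_inv]
    field_simp
    rw [hsqa, hsqb]
    ring
  simp only [inner_dilatedGaussLp_dilatedGaussLp, Positive.coe_inv, hinv]

theorem integrable_mul_dilatedGauss (hα : -1 < α) {a : ℝ} (ha : 0 < a) (f : L2 α) :
    Integrable (fun x => f x * dilatedGauss α a x) (muAlpha α) :=
  (Lp.memLp f).integrable_mul (memLp_dilatedGauss hα ha)

theorem topologicalClosure_span_dilatedGaussLp (hα : -1 < α) :
    (Submodule.span ℂ (Set.range (dilatedGaussLp hα))).topologicalClosure = ⊤ := by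
  rw [Submodule.topologicalClosure_eq_top_iff, Submodule.eq_bot_iff]
  intro f hf
  rw [Lp.eq_zero_iff_ae_eq_zero]
  refine ae_eq_zero_of_integral_mul_dilatedGauss_eq_zero
    (integrable_mul_dilatedGauss hα one_pos f) fun a ha => ?_
  rw [← inner_dilatedGaussLp hα ⟨a, ha⟩]
  exact (Submodule.mem_orthogonal _ _).1 hf _ (Submodule.subset_span (Set.mem_range_self _))

theorem exists_unitary_dilatedGaussLp (hα : -1 < α) :
    ∃ U : L2 α ≃ₗᵢ[ℂ] L2 α, ∀ a, U (dilatedGaussLp hα a) = dilatedGaussLp hα a⁻¹ := by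
  have htotal := topologicalClosure_span_dilatedGaussLp hα
  refine exists_linearIsometryEquiv_of_inner_eq htotal ?_
    fun a b => (inner_dilatedGaussLp_inv hα a b).symm
  rwa [← (Equiv.inv {a : ℝ // 0 < a}).surjective.range_comp] at htotal

variable {f g : ℝ → ℂ}

theorem integrable_besselj_mul_mul (hα : -1 / 2 ≤ α) (hf : Integrable f (muAlpha α))
    (hg : Integrable g (muAlpha α)) :
    Integrable (fun p : ℝ × ℝ => (besselj α (2 * Real.pi * p.1 * p.2) : ℂ) * (f p.1 * g p.2))
      ((muAlpha α).prod (muAlpha α)) := by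
  obtain ⟨C, hC⟩ := exists_bound_besselj hα
  refine (hf.mul_prod hg).bdd_mul (c := C) (Continuous.aestronglyMeasurable ?_)
    (.of_forall fun p => ?_)
  · have := continuous_besselj α
    fun_prop
  · rw [Complex.norm_real]
    exact hC _

theorem fourierBesselIntegral_mul (α : ℝ) (f g : ℝ → ℂ) (y : ℝ) :
    fourierBesselIntegral α f y * g y =
      ∫ x, (besselj α (2 * Real.pi * x * y) : ℂ) * (f x * g y) ∂(muAlpha α) := by
  rw [fourierBesselIntegral, ← integral_mul_const]
  congr 1 with x
  ring

theorem integrable_fourierBesselIntegral_mul (hα : -1 / 2 ≤ α) (hf : Integrable f (muAlpha α))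
    (hg : Integrable g (muAlpha α)) :
    Integrable (fun y => fourierBesselIntegral α f y * g y) (muAlpha α) := by
  simp only [fourierBesselIntegral_mul]
  exact (integrable_besselj_mul_mul hα hf hg).integral_prod_right

theorem integral_fourierBesselIntegral_mul (hα : -1 / 2 ≤ α) (hf : Integrable f (muAlpha α))
    (hg : Integrable g (muAlpha α)) :
    ∫ y, fourierBesselIntegral α f y * g y ∂(muAlpha α) =
      ∫ x, f x * fourierBesselIntegral α g x ∂(muAlpha α) := by
  calc _ = ∫ y, ∫ x, (besselj α (2 * Real.pi * x * y) : ℂ) * (f x * g y)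
          ∂(muAlpha α) ∂(muAlpha α) := by simp only [fourierBesselIntegral_mul]
    _ = ∫ x, ∫ y, (besselj α (2 * Real.pi * x * y) : ℂ) * (f x * g y)
          ∂(muAlpha α) ∂(muAlpha α) :=
        (integral_integral_swap (integrable_besselj_mul_mul hα hf hg)).symm
    _ = _ := by
        congr 1 with x
        rw [mul_comm (f x), fourierBesselIntegral_mul]
        congr 1 with y
        rw [mul_right_comm _ y x, mul_comm (g y)]

theorem inner_dilatedGaussLp_of_integrable (hα : -1 / 2 ≤ α) {f : L2 α}
    (hf : Integrable f (muAlpha α)) (a : {a : ℝ // 0 < a}) :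
    inner ℂ (dilatedGaussLp (by linarith) a⁻¹) f =
      ∫ y, fourierBesselIntegral α f y * dilatedGauss α a y ∂(muAlpha α) := by
  have hα' : -1 < α := by linarith
  rw [integral_fourierBesselIntegral_mul hα hf (integrable_dilatedGauss hα' a.2),
    inner_dilatedGaussLp, fourierBesselIntegral_dilatedGauss hα' a.2, Positive.coe_inv]

theorem exists_isFourierBessel (hα : -1 / 2 ≤ α) : ∃ U, IsFourierBessel α U := by
  have hα' : -1 < α := by linarith
  obtain ⟨U, hU⟩ := exists_unitary_dilatedGaussLp hα'
  refine ⟨U, fun f hf => ?_⟩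
  have hUint {a : ℝ} (ha : 0 < a) := integrable_mul_dilatedGauss hα' ha (U f)
  have hFint {a : ℝ} (ha : 0 < a) :=
    integrable_fourierBesselIntegral_mul hα hf (integrable_dilatedGauss hα' ha)
  have hpair (a : {a : ℝ // 0 < a}) : ∫ y, U f y * dilatedGauss α a y ∂(muAlpha α) =
      ∫ y, fourierBesselIntegral α f y * dilatedGauss α a y ∂(muAlpha α) := by
    rw [← inner_dilatedGaussLp hα' a, ← inner_dilatedGaussLp_of_integrable hα hf,
      ← U.inner_map_map _ f, hU, inv_inv]
  have hdiff : (fun y => U f y - fourierBesselIntegral α f y) =ᵐ[muAlpha α] 0 := by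
    refine ae_eq_zero_of_integral_mul_dilatedGauss_eq_zero (α := α) ?_ fun a ha => ?_
    · simp only [sub_mul]
      exact (hUint one_pos).sub (hFint one_pos)
    · simp only [sub_mul]
      rw [integral_sub (hUint ha) (hFint ha), sub_eq_zero]
      exact hpair ⟨a, ha⟩
  filter_upwards [hdiff] with y hy
  exact sub_eq_zero.1 hy

theorem isFourierBessel_fourierBessel (hα : -1 / 2 ≤ α) :
    IsFourierBessel α (fourierBessel α) := by
  rw [fourierBessel, dif_pos (exists_isFourierBessel hα)]
  exact (exists_isFourierBessel hα).choose_spec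

end Unitary

section HilbertSchmidt

variable {ι H : Type*} [NormedAddCommGroup H] [InnerProductSpace ℂ H]

theorem tsum_enorm_inner_sq (b : HilbertBasis ι ℂ H) (x : H) :
    ∑' i, ‖inner ℂ (b i) x‖ₑ ^ 2 = ‖x‖ₑ ^ 2 := by
  have h : HasSum (fun i => ‖inner ℂ (b i) x‖ ^ 2) (‖x‖ ^ 2) := by
    have hprod := b.hasSum_inner_mul_inner x x
    simp only [← inner_conj_symm x (b _), RCLike.conj_mul, inner_self_eq_norm_sq_to_K] at hprod
    exact_mod_cast hprod
  simp only [← ofReal_norm, ← ENNReal.ofReal_pow (norm_nonneg _)]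
  rw [← ENNReal.ofReal_tsum_of_nonneg (fun _ => by positivity) h.summable, h.tsum_eq]

theorem sq_hilbertSchmidtNorm (b : HilbertBasis ι ℂ H) (T : H →L[ℂ] H) :
    hilbertSchmidtNorm b T ^ 2 = ∑' i, ‖T (b i)‖ₑ ^ 2 := by
  rw [hilbertSchmidtNorm, ← ENNReal.rpow_two, ← ENNReal.rpow_mul]
  norm_num

theorem enorm_le_hilbertSchmidtNorm [CompleteSpace H] (b : HilbertBasis ι ℂ H) (T : H →L[ℂ] H) :
    ‖T‖ₑ ≤ hilbertSchmidtNorm b T := by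
  rw [← LinearIsometryEquiv.enorm_map ContinuousLinearMap.adjoint T]
  refine ContinuousLinearMap.opENorm_le_bound _ fun y => ?_
  rw [← ENNReal.pow_le_pow_left_iff two_ne_zero, mul_pow, sq_hilbertSchmidtNorm,
    ← tsum_enorm_inner_sq b, ← ENNReal.tsum_mul_right]
  gcongr with i
  rw [ContinuousLinearMap.adjoint_inner_right, ← mul_pow]
  gcongr
  simpa only [← ofReal_norm, ← ENNReal.ofReal_mul (norm_nonneg _)]
    using ENNReal.ofReal_le_ofReal (norm_inner_le_norm (T (b i)) y)

end HilbertSchmidt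

section Kernel

variable {𝕜 X Y ι : Type*} [RCLike 𝕜] [MeasurableSpace X] [MeasurableSpace Y] {μ : Measure X}
  {ν : Measure Y}

theorem sq_eLpNorm_two (f : X → 𝕜) : eLpNorm f 2 μ ^ 2 = ∫⁻ x, ‖f x‖ₑ ^ 2 ∂μ := by
  simpa using eLpNorm_nnreal_pow_eq_lintegral (f := f) (μ := μ) (p := 2) two_ne_zero

theorem sum_enorm_integral_mul_sq_le {v : ι → Lp 𝕜 2 μ} (hv : Orthonormal 𝕜 v) {k : X → 𝕜}
    (hk : AEStronglyMeasurable k μ) (s : Finset ι) :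
    ∑ i ∈ s, ‖∫ x, v i x * k x ∂μ‖ₑ ^ 2 ≤ ∫⁻ x, ‖k x‖ₑ ^ 2 ∂μ := by
  by_cases hfin : ∫⁻ x, ‖k x‖ₑ ^ 2 ∂μ = ⊤
  · exact hfin ▸ le_top
  have hmem : MemLp (star k) 2 μ := by
    refine MemLp.star ⟨hk, lt_top_iff_ne_top.2 fun h => hfin ?_⟩
    rw [← sq_eLpNorm_two, h, ENNReal.top_pow two_ne_zero]
  have hinner (i : ι) : inner 𝕜 (hmem.toLp _) (v i) = ∫ x, v i x * k x ∂μ := by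
    rw [L2.inner_def]
    refine integral_congr_ae ?_
    filter_upwards [hmem.coeFn_toLp] with x hx
    simp [hx, RCLike.inner_apply]
  calc ∑ i ∈ s, ‖∫ x, v i x * k x ∂μ‖ₑ ^ 2
      = ENNReal.ofReal (∑ i ∈ s, ‖inner 𝕜 (v i) (hmem.toLp _)‖ ^ 2) := by
        rw [ENNReal.ofReal_sum_of_nonneg fun _ _ => by positivity]
        simp only [← hinner, norm_inner_symm (v _), ENNReal.ofReal_pow (norm_nonneg _), ofReal_norm]
    _ ≤ ENNReal.ofReal (‖hmem.toLp _‖ ^ 2) :=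
        ENNReal.ofReal_le_ofReal (hv.sum_inner_products_le _)
    _ = ∫⁻ x, ‖k x‖ₑ ^ 2 ∂μ := by
        rw [ENNReal.ofReal_pow (norm_nonneg _), ofReal_norm, Lp.enorm_toLp, sq_eLpNorm_two]
        simp

theorem sum_lintegral_enorm_sq_le_of_kernel {v : ι → Lp 𝕜 2 μ} (hv : Orthonormal 𝕜 v)
    {k : Y → X → 𝕜} (hk : ∀ y, AEStronglyMeasurable (k y) μ) {g : ι → Y → 𝕜}
    (hgm : ∀ i, AEStronglyMeasurable (g i) ν)
    (hg : ∀ i, g i =ᵐ[ν] fun y => ∫ x, v i x * k y x ∂μ) (s : Finset ι) :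
    ∑ i ∈ s, ∫⁻ y, ‖g i y‖ₑ ^ 2 ∂ν ≤ ∫⁻ y, ∫⁻ x, ‖k y x‖ₑ ^ 2 ∂μ ∂ν := by
  rw [← lintegral_finsetSum' _ fun i _ => (hgm i).enorm.pow_const 2]
  refine lintegral_mono_ae ?_
  filter_upwards [(ae_ball_iff s.countable_toSet).2 fun i _ => hg i] with y hy
  rw [Finset.sum_congr rfl fun i hi => by rw [hy i hi]]
  exact sum_enorm_integral_mul_sq_le hv (hk y) s

end Kernel

section Projections

variable {α : ℝ} {S : Set ℝ}

theorem coeFn_projE (α : ℝ) (hS : MeasurableSet S) (f : L2 α) :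
    (projE α S hS f : ℝ → ℂ) =ᵐ[muAlpha α] S.indicator f :=
  coeFn_chiMul S hS f

theorem enorm_projE_sq (hS : MeasurableSet S) (f : L2 α) :
    ‖projE α S hS f‖ₑ ^ 2 = ∫⁻ x in S, ‖f x‖ₑ ^ 2 ∂(muAlpha α) := by
  rw [Lp.enorm_def, eLpNorm_congr_ae (coeFn_projE α hS f), eLpNorm_indicator_eq_eLpNorm_restrict hS,
    sq_eLpNorm_two]

theorem norm_projF (hS : MeasurableSet S) (f : L2 α) :
    ‖projF α S hS f‖ = ‖projE α S hS (fourierBessel α f)‖ := by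
  rw [← fourierBessel_projF, LinearIsometryEquiv.norm_map]

theorem enorm_projF_sq (hS : MeasurableSet S) (f : L2 α) :
    ‖projF α S hS f‖ₑ ^ 2 = ∫⁻ y in S, ‖fourierBessel α f y‖ₑ ^ 2 ∂(muAlpha α) := by
  rw [← enorm_projE_sq hS, ← ofReal_norm, norm_projF, ofReal_norm]

theorem projE_sub_projE_inter {A : Set ℝ} (hS : MeasurableSet S) (hA : MeasurableSet A)
    (f : L2 α) : projE α S hS f - projE α (S ∩ A) (hS.inter hA) f =
      projE α (S \ A) (hS.diff hA) f := by
  refine Lp.ext ?_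
  filter_upwards [Lp.coeFn_sub (projE α S hS f) (projE α (S ∩ A) (hS.inter hA) f),
    coeFn_projE α hS f, coeFn_projE α (hS.inter hA) f, coeFn_projE α (hS.diff hA) f]
    with x hsub hES hESA hEdiff
  rw [hsub, Pi.sub_apply, hES, hESA, hEdiff]
  by_cases hxS : x ∈ S <;> by_cases hxA : x ∈ A <;> simp [hxS, hxA]

theorem tendsto_projE_inter_spanningSets (hS : MeasurableSet S) (f : L2 α) :
    Tendsto (fun n => projE α (S ∩ spanningSets (muAlpha α) n)
      (hS.inter (measurableSet_spanningSets _ n)) f) atTop (𝓝 (projE α S hS f)) := by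
  have hm (n : ℕ) : MeasurableSet (S \ spanningSets (muAlpha α) n) :=
    hS.diff (measurableSet_spanningSets _ n)
  have hfin : ∫⁻ x, ‖f x‖ₑ ^ 2 ∂(muAlpha α) ≠ ⊤ := by
    rw [← sq_eLpNorm_two, ← Lp.enorm_def]
    exact ENNReal.pow_ne_top enorm_ne_top
  have hlim : Tendsto (fun n => ∫⁻ x, (S \ spanningSets (muAlpha α) n).indicator
      (fun x => ‖f x‖ₑ ^ 2) x ∂(muAlpha α)) atTop (𝓝 (∫⁻ _, 0 ∂(muAlpha α))) := by
    refine tendsto_lintegral_of_dominated_convergence' _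
      (fun n => ((Lp.aestronglyMeasurable f).enorm.pow_const 2).indicator (hm n))
      (fun n => .of_forall (Set.indicator_le_self _ _)) hfin (.of_forall fun x => ?_)
    refine tendsto_const_nhds.congr' ?_
    filter_upwards [eventually_mem_spanningSets (muAlpha α) x] with n hn
    exact (Set.indicator_of_notMem (fun hx => hx.2 hn) _).symm
  refine tendsto_iff_edist_tendsto_0.2 ?_
  have hsqrt := hlim.ennrpow_const (1 / 2)
  rw [lintegral_zero, ENNReal.zero_rpow_of_pos one_half_pos] at hsqrt
  refine hsqrt.congr fun n => ?_
  rw [edist_comm, edist_eq_enorm_sub, projE_sub_projE_inter hS (measurableSet_spanningSets _ n),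
    lintegral_indicator (hm n), ← enorm_projE_sq (hm n), ← ENNReal.rpow_natCast_mul]
  norm_num

end Projections

section KernelBound

variable {α κ : ℝ} {S T : Set ℝ}

theorem setLIntegral_muAlpha_le (α : ℝ) (hS : MeasurableSet S) (g : ℝ → ℝ≥0∞) :
    ∫⁻ x in S, g x ∂(muAlpha α) ≤
      ∫⁻ x in S ∩ Set.Ioi 0, ENNReal.ofReal (muAlphaDensity α x) * g x := by
  rw [muAlpha_eq, restrict_withDensity hS, Measure.restrict_restrict hS]
  exact lintegral_withDensity_le_lintegral_mul _ (measurable_muAlphaDensity α).ennreal_ofReal g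

theorem setLIntegral_setLIntegral_muAlpha_le (hS : MeasurableSet S) (hT : MeasurableSet T)
    {g : ℝ → ℝ → ℝ≥0∞} {C : ℝ≥0∞}
    (hg : ∀ x y, 0 < x → 0 < y →
      ENNReal.ofReal (muAlphaDensity α y) * (ENNReal.ofReal (muAlphaDensity α x) * g y x) ≤ C) :
    ∫⁻ y in T, ∫⁻ x in S, g y x ∂(muAlpha α) ∂(muAlpha α) ≤ C * (volume S * volume T) := by
  have hT₀ := hT.inter (measurableSet_Ioi (a := (0 : ℝ)))
  have hS₀ := hS.inter (measurableSet_Ioi (a := (0 : ℝ)))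
  calc _ ≤ ∫⁻ y in T ∩ Set.Ioi 0, ENNReal.ofReal (muAlphaDensity α y) *
          ∫⁻ x in S, g y x ∂(muAlpha α) := setLIntegral_muAlpha_le α hT _
    _ ≤ ∫⁻ _ in T ∩ Set.Ioi 0, C * volume S := setLIntegral_mono' hT₀ fun y hy => ?_
    _ ≤ C * (volume S * volume T) := by
        rw [setLIntegral_const, mul_assoc]
        gcongr
        exact Set.inter_subset_left
  calc _ ≤ ENNReal.ofReal (muAlphaDensity α y) *
          ∫⁻ x in S ∩ Set.Ioi 0, ENNReal.ofReal (muAlphaDensity α x) * g y x := by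
        exact mul_le_mul_right (setLIntegral_muAlpha_le α hS _) _
    _ = ∫⁻ x in S ∩ Set.Ioi 0, ENNReal.ofReal (muAlphaDensity α y) *
          (ENNReal.ofReal (muAlphaDensity α x) * g y x) :=
        (lintegral_const_mul' _ _ ENNReal.ofReal_ne_top).symm
    _ ≤ ∫⁻ _ in S ∩ Set.Ioi 0, C := setLIntegral_mono' hS₀ fun x hx => hg x y hx.2 hy.2
    _ ≤ C * volume S := by
        rw [setLIntegral_const]
        gcongr
        exact Set.inter_subset_left

theorem BesselBound.density_mul_sq_le (hκ : BesselBound α κ) {x y : ℝ} (hx : 0 < x)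
    (hy : 0 < y) :
    muAlphaDensity α y * (muAlphaDensity α x * besselj α (2 * Real.pi * x * y) ^ 2) ≤
      κ ^ 2 * (2 * Real.pi) := by
  have hπ : 0 < 2 * Real.pi := by positivity
  have ht : 0 < 2 * Real.pi * x * y := by positivity
  have hexp : ((2 * Real.pi * x * y) ^ (-α - 1 / 2)) ^ 2 =
      (2 * Real.pi) ^ (-(2 * α + 1)) * x ^ (-(2 * α + 1)) * y ^ (-(2 * α + 1)) := by
    rw [← Real.rpow_mul_natCast ht.le, Real.mul_rpow (by positivity) hy.le,
      Real.mul_rpow hπ.le hx.le]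
    congr 3 <;> push_cast <;> ring
  have hdensity : muAlphaDensity α y * muAlphaDensity α x * (κ ^ 2 *
      ((2 * Real.pi * x * y) ^ (-α - 1 / 2)) ^ 2) = κ ^ 2 * (2 * Real.pi) := by
    rw [hexp, muAlphaDensity, muAlphaDensity, Real.rpow_neg hπ.le, Real.rpow_neg hx.le,
      Real.rpow_neg hy.le, show 2 * α + 1 = α + 1 + α by ring, Real.rpow_add hπ (α + 1) α,
      Real.rpow_add_one hπ.ne']
    field_simp
  rw [← mul_assoc, ← hdensity, ← mul_pow]
  refine mul_le_mul_of_nonneg_left ?_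
    (mul_nonneg (muAlphaDensity_pos α hy).le (muAlphaDensity_pos α hx).le)
  exact sq_le_sq' (neg_le_of_abs_le (hκ _ ht)) (le_of_abs_le (hκ _ ht))

theorem BesselBound.setLIntegral_enorm_sq_le (hκ : BesselBound α κ) (hS : MeasurableSet S)
    (hT : MeasurableSet T) :
    ∫⁻ y in T, ∫⁻ x in S, ‖(besselj α (2 * Real.pi * x * y) : ℂ)‖ₑ ^ 2
        ∂(muAlpha α) ∂(muAlpha α) ≤
      ENNReal.ofReal (κ ^ 2 * (2 * Real.pi)) * (volume S * volume T) := by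
  refine setLIntegral_setLIntegral_muAlpha_le hS hT fun x y hx hy => ?_
  have hwx := (muAlphaDensity_pos α hx).le
  have hwy := (muAlphaDensity_pos α hy).le
  rw [← ofReal_norm, Complex.norm_real, Real.norm_eq_abs, ← ENNReal.ofReal_pow (abs_nonneg _),
    sq_abs, ← ENNReal.ofReal_mul hwx, ← ENNReal.ofReal_mul hwy]
  exact ENNReal.ofReal_le_ofReal (hκ.density_mul_sq_le hx hy)

end KernelBound

section HilbertSchmidtBound

variable {α κ : ℝ} {S T : Set ℝ}

theorem integrable_projE (hS : MeasurableSet S) (hμS : muAlpha α S ≠ ⊤) (f : L2 α) :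
    Integrable (projE α S hS f) (muAlpha α) := by
  have : IsFiniteMeasure ((muAlpha α).restrict S) := ⟨by simpa using hμS.lt_top⟩
  have hfS : IntegrableOn f S (muAlpha α) := ((Lp.memLp f).restrict S).integrable one_le_two
  exact (hfS.integrable_indicator hS).congr (coeFn_projE α hS f).symm

theorem fourierBessel_projE_ae_eq (hα : -1 / 2 ≤ α) (hS : MeasurableSet S)
    (hμS : muAlpha α S ≠ ⊤) (f : L2 α) :
    fourierBessel α (projE α S hS f) =ᵐ[muAlpha α] fun y =>
      ∫ x, f x * S.indicator (fun x => (besselj α (2 * Real.pi * x * y) : ℂ)) x ∂(muAlpha α) := by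
  filter_upwards [isFourierBessel_fourierBessel hα _ (integrable_projE hS hμS f)] with y hy
  rw [hy, fourierBesselIntegral]
  refine integral_congr_ae ?_
  filter_upwards [coeFn_projE α hS f] with x hx
  by_cases hxS : x ∈ S <;> simp [hx, hxS]

theorem sum_enorm_projF_projE_sq_le_of_muAlpha_ne_top (hα : -1 / 2 ≤ α) (hκ : BesselBound α κ)
    (hS : MeasurableSet S) (hT : MeasurableSet T) (hμS : muAlpha α S ≠ ⊤) {ι : Type*}
    {v : ι → L2 α} (hv : Orthonormal ℂ v) (s : Finset ι) :
    ∑ i ∈ s, ‖projF α T hT (projE α S hS (v i))‖ₑ ^ 2 ≤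
      ENNReal.ofReal (κ ^ 2 * (2 * Real.pi)) * (volume S * volume T) := by
  have hj := continuous_besselj α
  have hmeas (y : ℝ) : AEStronglyMeasurable (S.indicator fun x =>
      (besselj α (2 * Real.pi * x * y) : ℂ)) (muAlpha α) :=
    (Continuous.aestronglyMeasurable (by fun_prop)).indicator hS
  have hindicator (y : ℝ) : ∫⁻ x, ‖S.indicator (fun x =>
      (besselj α (2 * Real.pi * x * y) : ℂ)) x‖ₑ ^ 2 ∂(muAlpha α) =
      ∫⁻ x in S, ‖(besselj α (2 * Real.pi * x * y) : ℂ)‖ₑ ^ 2 ∂(muAlpha α) := by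
    rw [← sq_eLpNorm_two, eLpNorm_indicator_eq_eLpNorm_restrict hS, sq_eLpNorm_two]
  simp only [enorm_projF_sq]
  refine (sum_lintegral_enorm_sq_le_of_kernel hv hmeas
    (fun i => (Lp.aestronglyMeasurable _).restrict)
    (fun i => ae_restrict_of_ae (fourierBessel_projE_ae_eq hα hS hμS (v i))) s).trans ?_
  simp only [hindicator]
  exact hκ.setLIntegral_enorm_sq_le hS hT

theorem sum_enorm_projF_projE_sq_le (hα : -1 / 2 ≤ α) (hκ : BesselBound α κ)
    (hS : MeasurableSet S) (hT : MeasurableSet T) {ι : Type*} {v : ι → L2 α}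
    (hv : Orthonormal ℂ v) (s : Finset ι) :
    ∑ i ∈ s, ‖projF α T hT (projE α S hS (v i))‖ₑ ^ 2 ≤
      ENNReal.ofReal (κ ^ 2 * (2 * Real.pi)) * (volume S * volume T) := by
  refine le_of_tendsto' (tendsto_finsetSum s fun i _ => ENNReal.Tendsto.pow (n := 2)
    ((((projF α T hT).continuous.tendsto _).comp
      (tendsto_projE_inter_spanningSets hS (v i))).enorm)) fun n => ?_
  refine (sum_enorm_projF_projE_sq_le_of_muAlpha_ne_top hα hκ
    (hS.inter (measurableSet_spanningSets _ n)) hT ?_ hv s).trans ?_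
  · exact measure_ne_top_of_subset Set.inter_subset_right
      (measure_spanningSets_lt_top _ n).ne
  · gcongr
    exact Set.inter_subset_left

theorem hilbertSchmidtNorm_projF_projE_le (hα : -1 / 2 ≤ α) (hκ : BesselBound α κ)
    (hS : MeasurableSet S) (hT : MeasurableSet T) (hvS : volume S ≠ ⊤) (hvT : volume T ≠ ⊤)
    {ι : Type*} (b : HilbertBasis ι ℂ (L2 α)) :
    hilbertSchmidtNorm b (projF α T hT ∘L projE α S hS) ≤
      ENNReal.ofReal (κ * √(2 * Real.pi * (volume.real S * volume.real T))) := by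
  have hκ0 := hκ.nonneg
  rw [← ENNReal.pow_le_pow_left_iff two_ne_zero, sq_hilbertSchmidtNorm]
  calc _ ≤ ENNReal.ofReal (κ ^ 2 * (2 * Real.pi)) * (volume S * volume T) :=
        ENNReal.tsum_eq_iSup_sum.trans_le
          (iSup_le (sum_enorm_projF_projE_sq_le hα hκ hS hT b.orthonormal))
    _ = ENNReal.ofReal (κ * √(2 * Real.pi * (volume.real S * volume.real T))) ^ 2 := by
        rw [← ofReal_measureReal hvS, ← ofReal_measureReal hvT,
          ← ENNReal.ofReal_mul (by positivity), ← ENNReal.ofReal_mul (by positivity),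
          ← ENNReal.ofReal_pow (by positivity), mul_pow, Real.sq_sqrt (by positivity), mul_assoc]

end HilbertSchmidtBound

section AnnihilatingPair

variable {𝕜 V : Type*} [NontriviallyNormedField 𝕜] [SeminormedAddCommGroup V] [NormedSpace 𝕜 V]

theorem norm_le_of_norm_mul_le {E F : V →L[𝕜] V} (hE : IsIdempotentElem E) (hF : ‖1 - F‖ ≤ 1)
    {c : ℝ} (hc : c < 1) (hFE : ‖F * E‖ ≤ c) (f : V) :
    ‖f‖ ≤ (1 + 1 / (1 - c)) * (‖(1 - E) f‖ + ‖(1 - F) f‖) := by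
  have hEE : E (E f) = E f := DFunLike.congr_fun hE f
  have hdecomp (G : V →L[𝕜] V) (g : V) : ‖g‖ ≤ ‖G g‖ + ‖(1 - G) g‖ := by
    simpa using norm_add_le (G g) ((1 - G) g)
  have hFEf : ‖F (E f)‖ ≤ c * ‖E f‖ := by
    simpa [hEE] using (F * E).le_of_opNorm_le hFE (E f)
  have hFcE : ‖(1 - F) (E f)‖ ≤ ‖(1 - F) f‖ + ‖(1 - E) f‖ := by
    calc _ = ‖(1 - F) f - (1 - F) ((1 - E) f)‖ := by rw [← map_sub]; simp
      _ ≤ ‖(1 - F) f‖ + ‖(1 - F) ((1 - E) f)‖ := norm_sub_le _ _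
      _ ≤ _ := by
        gcongr
        simpa using (1 - F).le_of_opNorm_le hF ((1 - E) f)
  have hEf : ‖E f‖ ≤ 1 / (1 - c) * (‖(1 - E) f‖ + ‖(1 - F) f‖) := by
    rw [one_div_mul_eq_div, le_div_iff₀ (sub_pos.2 hc)]
    linarith [hdecomp F (E f)]
  linarith [hdecomp E f, norm_nonneg ((1 - F) f)]

end AnnihilatingPair

section Complement

variable {α : ℝ} {S T : Set ℝ}

theorem isIdempotentElem_projE (hS : MeasurableSet S) : IsIdempotentElem (projE α S hS) := by
  refine ContinuousLinearMap.ext fun f => Lp.ext ?_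
  filter_upwards [coeFn_projE α hS f, coeFn_projE α hS (projE α S hS f)] with x hf hEf
  rw [mul_apply_eq_comp, hEf, hf]
  by_cases hx : x ∈ S <;> simp [hx, hf]

theorem one_sub_projE (hS : MeasurableSet S) :
    1 - projE α S hS = projE α (Set.Ici 0 \ S) (measurableSet_Ici.diff hS) := by
  refine ContinuousLinearMap.ext fun f => Lp.ext ?_
  filter_upwards [Lp.coeFn_sub f (projE α S hS f), coeFn_projE α hS f,
    coeFn_projE α (measurableSet_Ici.diff hS) f, ae_muAlpha_pos α] with x hsub hES hEc hx
  rw [sub_apply, one_apply_eq_self, hsub, Pi.sub_apply, hES, hEc]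
  by_cases hxS : x ∈ S <;> simp [hxS, hx.le]

theorem one_sub_projF (hS : MeasurableSet S) :
    1 - projF α S hS = projF α (Set.Ici 0 \ S) (measurableSet_Ici.diff hS) := by
  refine ContinuousLinearMap.ext fun f => (fourierBessel α).injective ?_
  rw [fourierBessel_projF, ← one_sub_projE hS]
  simp [fourierBessel_projF]

theorem norm_projF_le (hS : MeasurableSet S) : ‖projF α S hS‖ ≤ 1 := by
  refine ContinuousLinearMap.opNorm_le_bound _ zero_le_one fun f => ?_
  rw [norm_projF, ← (fourierBessel α).norm_map f]
  exact norm_chiMul_le S hS _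

theorem norm_le_of_norm_projF_projE_le (hS : MeasurableSet S) (hT : MeasurableSet T) {c : ℝ}
    (hc : c < 1) (hFE : ‖projF α T hT ∘L projE α S hS‖ ≤ c) (f : L2 α) :
    ‖f‖ ≤ (1 + 1 / (1 - c)) * (‖projE α (Set.Ici 0 \ S) (measurableSet_Ici.diff hS) f‖ +
      ‖projF α (Set.Ici 0 \ T) (measurableSet_Ici.diff hT) f‖) := by
  rw [← one_sub_projE hS, ← one_sub_projF hT]
  exact norm_le_of_norm_mul_le (isIdempotentElem_projE hS)
    (one_sub_projF hT ▸ norm_projF_le _) hc hFE f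

theorem norm_projF_projE_le {κ : ℝ} (hα : -1 / 2 ≤ α) (hκ : BesselBound α κ)
    (hS : MeasurableSet S) (hT : MeasurableSet T) (hvS : volume S ≠ ⊤) (hvT : volume T ≠ ⊤) :
    ‖projF α T hT ∘L projE α S hS‖ ≤
      κ * √(2 * Real.pi * (volume.real S * volume.real T)) := by
  have hκ0 := hκ.nonneg
  obtain ⟨_, b, _⟩ := exists_hilbertBasis ℂ (L2 α)
  rw [← ENNReal.ofReal_le_ofReal_iff (by positivity), ofReal_norm]
  exact (enorm_le_hilbertSchmidtNorm b _).trans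
    (hilbertSchmidtNorm_projF_projE_le hα hκ hS hT hvS hvT b)

theorem mul_sqrt_lt_one_of_lt {κ p : ℝ} (hκ : 0 ≤ κ) (hp : 0 ≤ p)
    (h : p < (2 * Real.pi)⁻¹ * κ ^ (-2 : ℤ)) : κ * √(2 * Real.pi * p) < 1 := by
  have hκ_pos : 0 < κ := hκ.lt_of_ne fun hκ0 => by
    simp [← hκ0, hp.not_gt] at h
  rw [zpow_neg, ← mul_inv, ← one_div, lt_div_iff₀ (by positivity)] at h
  rw [← sq_lt_one_iff₀ (by positivity), mul_pow, Real.sq_sqrt (by positivity)]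
  calc _ = p * (2 * Real.pi * κ ^ (2 : ℤ)) := by norm_cast; ring
    _ < 1 := h

end Complement

end FourierBessel

end

theorem lemma4p2_general (α : ℝ) (hα : -1 / 2 ≤ α) :
    (∃ κ : ℝ, FourierBessel.BesselBound α κ) ∧
    ∀ κ : ℝ, FourierBessel.BesselBound α κ →
      ∀ (S T : Set ℝ) (hS : MeasurableSet S) (hT : MeasurableSet T),
        volume S ≠ ⊤ → volume T ≠ ⊤ →
        (∀ (ι : Type*) (b : HilbertBasis ι ℂ (FourierBessel.L2 α)),
          FourierBessel.hilbertSchmidtNorm b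
              (FourierBessel.projF α T hT ∘L FourierBessel.projE α S hS) ≤
            ENNReal.ofReal (κ * √(2 * Real.pi * (volume.real S * volume.real T)))) ∧
        (volume.real S * volume.real T < (2 * Real.pi)⁻¹ * κ ^ (-2 : ℤ) →
          ∀ f : FourierBessel.L2 α,
            ‖f‖ ≤ (1 + 1 / (1 - κ * √(2 * Real.pi * (volume.real S * volume.real T)))) *
              (‖FourierBessel.projE α (Set.Ici 0 \ S) (measurableSet_Ici.diff hS) f‖ +
                ‖FourierBessel.projF α (Set.Ici 0 \ T) (measurableSet_Ici.diff hT) f‖)) := by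
  refine ⟨FourierBessel.exists_besselBound hα, fun κ hκ S T hS hT hvS hvT => ⟨fun ι b => ?_,
    fun h f => ?_⟩⟩
  · exact FourierBessel.hilbertSchmidtNorm_projF_projE_le hα hκ hS hT hvS hvT b
  · exact FourierBessel.norm_le_of_norm_projF_projE_le hS hT
      (FourierBessel.mul_sqrt_lt_one_of_lt hκ.nonneg (by positivity) h)
      (FourierBessel.norm_projF_projE_le hα hκ hS hT hvS hvT) f

theorem lemma4p2 (α : ℝ) (hα : -1 / 2 < α) :
    (∃ κ : ℝ, FourierBessel.BesselBound α κ) ∧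
    ∀ κ : ℝ, FourierBessel.BesselBound α κ →
      ∀ (S T : Set ℝ) (hS : MeasurableSet S) (hT : MeasurableSet T),
        S ⊆ Set.Ici 0 → T ⊆ Set.Ici 0 → volume S ≠ ⊤ → volume T ≠ ⊤ →
        (∀ (ι : Type*) (b : HilbertBasis ι ℂ (FourierBessel.L2 α)),
          FourierBessel.hilbertSchmidtNorm b
              (FourierBessel.projF α T hT ∘L FourierBessel.projE α S hS) ≤
            ENNReal.ofReal (κ * √(2 * Real.pi * (volume.real S * volume.real T)))) ∧
        (volume.real S * volume.real T < (2 * Real.pi)⁻¹ * κ ^ (-2 : ℤ) →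
          ∀ f : FourierBessel.L2 α,
            ‖f‖ ≤ (1 + 1 / (1 - κ * √(2 * Real.pi * (volume.real S * volume.real T)))) *
              (‖FourierBessel.projE α (Set.Ici 0 \ S) (measurableSet_Ici.diff hS) f‖ +
                ‖FourierBessel.projF α (Set.Ici 0 \ T) (measurableSet_Ici.diff hT) f‖)) :=
  (lemma4p2_general α hα.le).imp_right fun h κ hκ S T hS hT _ _ => h κ hκ S T hS hT
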